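/- **Setting.** All triangulated categories have arbitrary set-indexed coproducts. An object $C$ of such a category $\mathsf T$ is *compact* if $\bigoplus_i \mathrm{Hom}(C,X_i)\to\mathrm{Hom}(C,\bigoplus_i X_i)$ is an isomorphism for every set-indexed family $(X_i)$; $\mathsf T^{c}$ is the full subcategory of compact objects. $\mathsf T$ is *compactly generated* if there is a set $\mathscr G$ of compact objects such that $X\cong 0$ if and only if $\mathrm{Hom}(\Sigma^n G,X)=0$ for all $G\in\mathscr G$, $n\in\mathbb Z$. $\mathrm{Mod}\,\mathsf T^{c}$ is the category of additive functors $(\mathsf T^{c})^{\mathrm{op}}\to\mathbf{Ab}$, and $\mathbf y\colon\mathsf T\to\mathrm{Mod}\,\mathsf T^{c}$, $\mathbf yX=\mathrm{Hom}_{\mathsf T}(-,X)|_{\mathsf T^{c}}$, is the restricted Yoneda functor. A triangle $X\xrightarrow{\alpha}Y\to Z\to\Sigma X$ is *pure* if $0\to\mathbf yX\to\mathbf yY\to\mathbf yZ\to0$ is exact; then $\alpha$ is a *pure monomorphism*. An object $X$ is *pure injective* if every pure monomorphism $X\to Y$ splits. Write $A^+=\mathrm{Hom}_{\mathbb Z}(A,\mathbb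 Q/\mathbb Z)$. A *duality triple* $(\mathsf T,\mathsf U,Q)$ consists of compactly generated triangulated categories $\mathsf T,\mathsf U$ and exact functors $Q\colon\mathsf T^{\mathrm{op}}\to\mathsf U$, $Q\colon\mathsf U^{\mathrm{op}}\to\mathsf T$ such that, on both sides: every $Q(X)$ is pure injective; there is a natural map $i_X\colon X\to Q^2(X)$ which is a pure monomorphism; $Q(i_X)\circ i_{Q(X)}=\mathrm{id}$; and $Q(\bigoplus_i X_i)\cong\prod_i Q(X_i)$, canonically, for every set-indexed family. An *Auslander–Gruson–Jensen (AGJ) duality triple* $(\mathsf T,\mathsf U,Q,D)$ is a duality triple with functors $D\colon(\mathsf T^{c})^{\mathrm{op}}\to\mathsf U^{c}$ and $D\colon(\mathsf U^{c})^{\mathrm{op}}\to\mathsf T^{c}$ that form an adjoint equivalence $\mathsf T^{c}\simeq(\mathsf U^{c})^{\mathrm{op}}$, together with isomorphisms of abelian groups $\mathrm{Hom}_{\mathsf T}(C,X)^+\cong\mathrm{Hom}_{\mathsf U}(DC,QX)$ natural in $C\in\mathsf T^{c}$, $X\in\mathsf T$, and $\mathrm{Hom}_{\mathsf U}(C',Y)^+\cong\mathrm{Hom}_{\mathsf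 T}(DC',QY)$ natural in $C'\in\mathsf U^{c}$, $Y\in\mathsf U$. It induces contravariant functors $\partial\colon\mathrm{Mod}\,\mathsf T^{c}\to\mathrm{Mod}\,\mathsf U^{c}$ and $\partial\colon\mathrm{Mod}\,\mathsf U^{c}\to\mathrm{Mod}\,\mathsf T^{c}$, both given by $(\partial F)(C)=\mathrm{Hom}_{\mathbb Z}(F(DC),\mathbb Q/\mathbb Z)$. Given categories $\mathcal C,\mathcal D$ and contravariant functors $Q\colon\mathcal C\to\mathcal D$, $Q\colon\mathcal D\to\mathcal C$, classes of objects $\mathsf A\subseteq\mathcal C$, $\mathsf B\subseteq\mathcal D$ form a *duality pair* $(\mathsf A,\mathsf B)$ on $(\mathcal C,\mathcal D,Q)$ if for all $X\in\mathcal C$ one has $X\in\mathsf A\iff Q(X)\in\mathsf B$, and $\mathsf B$ is closed under finite coproducts (including the empty one) and retracts. The pair is *symmetric* if both $(\mathsf A,\mathsf B)$ and $(\mathsf B,\mathsf A)$ are duality pairs. **Theorem.** Let $(\mathsf T,\mathsf U,Q,D)$ be an AGJ duality triple and let $(\mathsf X,\mathsf Y)$ be a symmetric duality pair on $(\mathsf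 T,\mathsf U,Q)$. Then there is a symmetric duality pair $(\mathsf A,\mathsf B)$ on $(\mathrm{Mod}\,\mathsf T^{c},\mathrm{Mod}\,\mathsf U^{c},\partial)$ such that $$\{X\in\mathsf T:\mathbf yX\in\mathsf A\}=\mathsf X\qquad\text{and}\qquad\{Y\in\mathsf U:\mathbf yY\in\mathsf B\}=\mathsf Y .$$ -/

import Mathlib

open CategoryTheory CategoryTheory.Limits CategoryTheory.Pretriangulated
open CategoryTheory.Pretriangulated.Opposite Opposite

universe v u u₁ u₂

namespace AGJ

noncomputable section

/-! ### Compact objects and purity -/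

section Triangulated

variable (T : Type u) [Category.{v} T] [Preadditive T] [HasCoproducts.{v} T]

variable {T} in
open Classical in
/-- `C` is compact: for every set-indexed family `X`, the natural map
`⨁ i, Hom(C, X i) → Hom(C, ∐ X)` is an isomorphism. -/
def IsCompactObj : ObjectProperty T := fun C =>
  ∀ (I : Type v) (X : I → T),
    Function.Bijective
      (DirectSum.toAddMonoid (fun i =>
        (Preadditive.rightComp C (Sigma.ι X i) : (C ⟶ X i) →+ (C ⟶ ∐ X))))

/-- The full subcategory `Tᶜ` of compact objects. -/
abbrev CompactObj := (IsCompactObj (T := T)).FullSubcategory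

/-- `Mod Tᶜ`: the category of additive functors `(Tᶜ)ᵒᵖ ⥤ Ab`. -/
abbrev ModCompact := (CompactObj T)ᵒᵖ ⥤+ AddCommGrpCat.{v}

/-- The restricted Yoneda functor `X ↦ Hom(-, X)|_{Tᶜ}`. -/
def restrictedYoneda : T ⥤ ModCompact T where
  obj X := AdditiveFunctor.of ((IsCompactObj (T := T)).ι.op ⋙ preadditiveYoneda.obj X)
  map f := ObjectProperty.homMk
    (Functor.whiskerLeft (IsCompactObj (T := T)).ι.op (preadditiveYoneda.map f))

variable [HasZeroObject T] [HasShift T ℤ] [∀ n : ℤ, (shiftFunctor T n).Additive]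
  [Pretriangulated T]

/-- `T` is compactly generated: there is a (small) set `G` of compact objects such that `X` is
zero iff every map from a shift of an object of `G` to `X` is zero. -/
def IsCompactlyGenerated : Prop :=
  ∃ G : Set T, Small.{v} G ∧ (∀ C ∈ G, IsCompactObj C) ∧
    ∀ X : T, IsZero X ↔ ∀ C ∈ G, ∀ (n : ℤ) (f : C⟦n⟧ ⟶ X), f = 0

variable {T}

/-- A distinguished triangle `X ⟶ Y ⟶ Z ⟶ X⟦1⟧` is pure if
`0 ⟶ Hom(C, X) ⟶ Hom(C, Y) ⟶ Hom(C, Z) ⟶ 0` is exact for every compact `C`, i.e. if its image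
under the restricted Yoneda functor is a short exact sequence in `Mod Tᶜ`. -/
structure IsPureTriangle (t : Triangle T) : Prop where
  distinguished : t ∈ distTriang T
  injective : ∀ C : T, IsCompactObj C →
    Function.Injective (fun g : C ⟶ t.obj₁ => g ≫ t.mor₁)
  exact : ∀ C : T, IsCompactObj C →
    Function.Exact (fun g : C ⟶ t.obj₁ => g ≫ t.mor₁) (fun g : C ⟶ t.obj₂ => g ≫ t.mor₂)
  surjective : ∀ C : T, IsCompactObj C →
    Function.Surjective (fun g : C ⟶ t.obj₂ => g ≫ t.mor₂)

/-- A pure monomorphism is the first map of a pure triangle. -/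
def IsPureMono {X Y : T} (α : X ⟶ Y) : Prop :=
  ∃ (Z : T) (β : Y ⟶ Z) (f : Z ⟶ X⟦(1 : ℤ)⟧), IsPureTriangle (Triangle.mk α β f)

/-- `X` is pure injective: every pure monomorphism out of `X` splits. -/
def IsPureInjective (X : T) : Prop :=
  ∀ ⦃Y : T⦄ (α : X ⟶ Y), IsPureMono α → IsSplitMono α

end Triangulated

/-! ### Duality triples -/

section Triples

variable (T : Type u₁) [Category.{v} T] [Preadditive T] [HasZeroObject T] [HasShift T ℤ]
  [∀ n : ℤ, (shiftFunctor T n).Additive] [Pretriangulated T] [HasCoproducts.{v} T]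
  (U : Type u₂) [Category.{v} U] [Preadditive U] [HasZeroObject U] [HasShift U ℤ]
  [∀ n : ℤ, (shiftFunctor U n).Additive] [Pretriangulated U] [HasCoproducts.{v} U]

/-- The data and axioms of a duality triple `(T, U, Q)`; the two functors called `Q` are `Q` and
`Q'` here. (That `T` and `U` are compactly generated is a separate hypothesis.) -/
structure DualityTriple where
  /-- the functor `Q : Tᵒᵖ ⥤ U` -/
  Q : Tᵒᵖ ⥤ U
  /-- the functor `Q : Uᵒᵖ ⥤ T` -/
  Q' : Uᵒᵖ ⥤ T
  /-- exactness of `Q`, `Q'`: they commute with the shift and preserve distinguished triangles -/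
  [commShiftQ : Q.CommShift ℤ]
  [commShiftQ' : Q'.CommShift ℤ]
  [isTriangulatedQ : Q.IsTriangulated]
  [isTriangulatedQ' : Q'.IsTriangulated]
  pureInjective_Q : ∀ X : T, IsPureInjective (Q.obj (op X))
  pureInjective_Q' : ∀ Y : U, IsPureInjective (Q'.obj (op Y))
  /-- the natural map `X ⟶ Q² X` for `X` in `T` -/
  i : 𝟭 T ⟶ Q.rightOp ⋙ Q'
  /-- the natural map `Y ⟶ Q² Y` for `Y` in `U` -/
  i' : 𝟭 U ⟶ Q'.rightOp ⋙ Q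
  pureMono_i : ∀ X : T, IsPureMono (i.app X)
  pureMono_i' : ∀ Y : U, IsPureMono (i'.app Y)
  /-- `Q(i_X) ∘ i_{Q X} = id` -/
  i'_comp_map_i : ∀ X : T, i'.app (Q.obj (op X)) ≫ Q.map (i.app X).op = 𝟙 (Q.obj (op X))
  i_comp_map_i' : ∀ Y : U, i.app (Q'.obj (op Y)) ≫ Q'.map (i'.app Y).op = 𝟙 (Q'.obj (op Y))
  /-- `Q` and `Q'` take set-indexed coproducts to products -/
  preservesProducts_Q : ∀ I : Type v, PreservesLimitsOfShape (Discrete I) Q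
  preservesProducts_Q' : ∀ I : Type v, PreservesLimitsOfShape (Discrete I) Q'

/-- An Auslander-Gruson-Jensen duality triple `(T, U, Q, D)`. The group `ℚ/ℤ` is
`AddCircle (1 : ℚ)`. -/
structure AGJDualityTriple extends DualityTriple T U where
  /-- the adjoint equivalence formed by the two functors `D` -/
  e : CompactObj T ≌ (CompactObj U)ᵒᵖ
  /-- `Hom_T(C, X)⁺ ≅ Hom_U(D C, Q X)` -/
  charIso : ∀ (C : CompactObj T) (X : T),
    ((C.obj ⟶ X) →+ AddCircle (1 : ℚ)) ≃+ ((e.functor.obj C).unop.obj ⟶ Q.obj (op X))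
  charIso_natural_left : ∀ {C C' : CompactObj T} (h : C ⟶ C') (X : T)
    (χ : (C.obj ⟶ X) →+ AddCircle (1 : ℚ)),
    charIso C' X (χ.comp (Preadditive.leftComp X h.hom)) =
      (e.functor.map h).unop.hom ≫ charIso C X χ
  charIso_natural_right : ∀ (C : CompactObj T) {X X' : T} (b : X ⟶ X')
    (χ : (C.obj ⟶ X') →+ AddCircle (1 : ℚ)),
    charIso C X (χ.comp (Preadditive.rightComp C.obj b)) = charIso C X' χ ≫ Q.map b.op
  /-- `Hom_U(C, Y)⁺ ≅ Hom_T(D C, Q Y)` -/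
  charIso' : ∀ (C : CompactObj U) (Y : U),
    ((C.obj ⟶ Y) →+ AddCircle (1 : ℚ)) ≃+ ((e.inverse.obj (op C)).obj ⟶ Q'.obj (op Y))
  charIso'_natural_left : ∀ {C C' : CompactObj U} (h : C ⟶ C') (Y : U)
    (χ : (C.obj ⟶ Y) →+ AddCircle (1 : ℚ)),
    charIso' C' Y (χ.comp (Preadditive.leftComp Y h.hom)) =
      (e.inverse.map h.op).hom ≫ charIso' C Y χ
  charIso'_natural_right : ∀ (C : CompactObj U) {Y Y' : U} (b : Y ⟶ Y')
    (χ : (C.obj ⟶ Y') →+ AddCircle (1 : ℚ)),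
    charIso' C Y (χ.comp (Preadditive.rightComp C.obj b)) = charIso' C Y' χ ≫ Q'.map b.op

end Triples

/-! ### The duality on functor categories -/

/-- The character dual `A ↦ Hom_ℤ(A, ℚ/ℤ)` on abelian groups. -/
def characterDual : AddCommGrpCat.{v}ᵒᵖ ⥤ AddCommGrpCat.{v} where
  obj A := AddCommGrpCat.of (A.unop →+ AddCircle (1 : ℚ))
  map f := AddCommGrpCat.ofHom (AddMonoidHom.compHom' f.unop.hom)

instance : (characterDual.{v}).Additive where
  map_add := by
    intro A B f g
    ext χ
    refine AddMonoidHom.ext fun a => ?_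
    let χ' : A.unop →+ AddCircle (1 : ℚ) := χ
    exact χ'.map_add (f.unop.hom a) (g.unop.hom a)

section Dual

variable {T : Type u₁} [Category.{v} T] [Preadditive T] [HasCoproducts.{v} T]
  {U : Type u₂} [Category.{v} U] [Preadditive U] [HasCoproducts.{v} U]

/-- For `D : (Uᶜ)ᵒᵖ ⥤ Tᶜ`, the contravariant functor `Mod Tᶜ → Mod Uᶜ`,
`F ↦ Hom_ℤ(F(D -), ℚ/ℤ)`. -/
def nerveDual (D : (CompactObj U)ᵒᵖ ⥤ CompactObj T) [D.Additive] :
    (ModCompact T)ᵒᵖ ⥤ ModCompact U where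
  obj F := AdditiveFunctor.of ((D.rightOp ⋙ F.unop.obj).op ⋙ characterDual)
  map α := ObjectProperty.homMk
    (Functor.whiskerRight (NatTrans.op (Functor.whiskerLeft D.rightOp α.unop.hom)) characterDual)

end Dual

namespace AGJDualityTriple

variable {T : Type u₁} [Category.{v} T] [Preadditive T] [HasZeroObject T] [HasShift T ℤ]
  [∀ n : ℤ, (shiftFunctor T n).Additive] [Pretriangulated T] [HasCoproducts.{v} T]
  {U : Type u₂} [Category.{v} U] [Preadditive U] [HasZeroObject U] [HasShift U ℤ]
  [∀ n : ℤ, (shiftFunctor U n).Additive] [Pretriangulated U] [HasCoproducts.{v} U]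
  (S : AGJDualityTriple T U)

/-- `D : (Tᶜ)ᵒᵖ ⥤ Uᶜ` -/
abbrev D : (CompactObj T)ᵒᵖ ⥤ CompactObj U := S.e.functor.leftOp

/-- `D : (Uᶜ)ᵒᵖ ⥤ Tᶜ` -/
abbrev D' : (CompactObj U)ᵒᵖ ⥤ CompactObj T := S.e.inverse

instance additive_e_functor : S.e.functor.Additive where
  map_add := by
    intro C C' f g
    apply Quiver.Hom.unop_inj
    apply ObjectProperty.hom_ext
    obtain ⟨Z, β, k, hp⟩ := S.pureMono_i' (S.e.functor.obj C).unop.obj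
    apply hp.injective _ (S.e.functor.obj C').unop.property
    obtain ⟨χ, hχ⟩ := (S.charIso C _).surjective (S.i'.app (S.e.functor.obj C).unop.obj)
    change (S.e.functor.map (f + g)).unop.hom ≫ S.i'.app (S.e.functor.obj C).unop.obj =
      ((S.e.functor.map f).unop.hom + (S.e.functor.map g).unop.hom) ≫
        S.i'.app (S.e.functor.obj C).unop.obj
    rw [Preadditive.add_comp]
    erw [← hχ]
    rw [← S.charIso_natural_left, ← S.charIso_natural_left, ← S.charIso_natural_left, ← map_add]
    congr 1
    ext x
    change χ ((f.hom + g.hom) ≫ x) = χ (f.hom ≫ x) + χ (g.hom ≫ x)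
    rw [Preadditive.add_comp, map_add]

/-- `∂ : (Mod Tᶜ)ᵒᵖ ⥤ Mod Uᶜ`, `∂ F = Hom_ℤ(F(D -), ℚ/ℤ)`. -/
abbrev partialDual : (ModCompact T)ᵒᵖ ⥤ ModCompact U := nerveDual S.D'

/-- `∂ : (Mod Uᶜ)ᵒᵖ ⥤ Mod Tᶜ`, `∂ G = Hom_ℤ(G(D -), ℚ/ℤ)`. -/
abbrev partialDual' : (ModCompact U)ᵒᵖ ⥤ ModCompact T := nerveDual S.D

end AGJDualityTriple

/-! ### Duality pairs -/

section Pairs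

variable {𝒞 : Type u₁} [Category* 𝒞] {𝒟 : Type u₂} [Category* 𝒟]

/-- `(A, B)` is a duality pair with respect to `Q : 𝒞ᵒᵖ ⥤ 𝒟`: `X ∈ A ↔ Q X ∈ B`, and `B` is closed
under finite coproducts (the empty one included) and retracts. -/
structure IsDualityPair (Q : 𝒞ᵒᵖ ⥤ 𝒟) (A : ObjectProperty 𝒞) (B : ObjectProperty 𝒟) : Prop where
  mem_iff : ∀ X : 𝒞, A X ↔ B (Q.obj (op X))
  finiteCoproducts : ∀ (J : Type) [Finite J], B.IsClosedUnderColimitsOfShape (Discrete J)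
  retracts : B.IsStableUnderRetracts

/-- `(A, B)` is symmetric: both `(A, B)` and `(B, A)` are duality pairs. -/
structure IsSymmetricDualityPair (Q : 𝒞ᵒᵖ ⥤ 𝒟) (Q' : 𝒟ᵒᵖ ⥤ 𝒞)
    (A : ObjectProperty 𝒞) (B : ObjectProperty 𝒟) : Prop where
  left : IsDualityPair Q A B
  right : IsDualityPair Q' B A

end Pairs

end

end AGJ

/-!
The class `A` consists of the functors `F` whose double dual `∂∂F` is a retract of `y Z` for some
`Z` in `X`, and `B` is defined in the same way from `Y` (`retractClass`).

Two properties of `∂` make `(A, B)` a symmetric duality pair. The isomorphisms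
`Hom(C, X)⁺ ≅ Hom(D C, Q X)` give `∂ (y X) ≅ y (Q X)` (`partialDualYonedaIso`), and `∂F` is a
retract of `∂∂∂F`, since the evaluation map `F ⟶ ∂∂F` satisfies a triangle identity
(`retractNerveDual`). Dualizing a retraction from `y Z` to `∂∂F` gives one from `y (Q Z)` to
`∂∂∂F`, so `F ∈ A` implies `∂F ∈ B`. If `∂F ∈ B`, then `∂∂∂∂F` is a retract of some `y (Q W)` with
`W` in `Y`, and `∂∂F` is a retract of `∂∂∂∂F`, so `F ∈ A` (`retractClass_iff_dual`). Closure under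
retracts is clear, and closure under finite coproducts follows from additivity of `∂` and `y`.

It remains to recover `X` from `A`. If `y Z ∈ A`, then applying `∂∂` once more gives a retraction
between `y (Q⁴ Z)` and `y (Q² Z')` with `Z'` in `X`. As these objects are pure injective, the
retraction comes from `T`, provided that `y` is fully faithful on maps into pure injective objects;
then `Q⁴ Z`, hence `Z`, belongs to `X` (`retractClass_obj_iff`). Faithfulness holds because a
phantom map into a pure injective object vanishes (`IsPureInjective.eq_zero_of_phantom`). For
fullness (`IsPureInjective.restrictedYoneda_map_surjective`), `Z` is covered by a small coproduct of
compact objects, and this requires the compact objects to be retracts of the members of a small family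
(`IsCompactlyGenerated.exists_small_retract`).

That smallness is a theorem of Neeman. Starting from a compact object `C`, all maps from the
generators are killed by successive cones `C = Z 0 ⟶ Z 1 ⟶ ⋯`. The map `1 - shift` on `∐ Z` is
then an isomorphism, so by compactness `C ⟶ Z n` vanishes for some `n`. A map from a compact object
killed by such a tower of cones factors through an iterated extension of generators
(`IsCellAttachment.kernelFactors_comp`), so `C` is a retract of one.
-/

namespace AGJ

noncomputable section

/-! ### Compact objects -/

section Compact

variable {T : Type u} [Category.{v} T] [Preadditive T] [HasCoproducts.{v} T]

open Classical in
/-- The idempotent endomorphism of `∐ X` that projects onto the summands indexed by `s`. -/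
def sigmaTrunc {I : Type v} (X : I → T) (s : Finset I) : ∐ X ⟶ ∐ X :=
  Sigma.desc fun i => if i ∈ s then Sigma.ι X i else 0

section

variable {I : Type v} (X : I → T)

lemma ι_sigmaTrunc_of_mem {s : Finset I} {i : I} (hi : i ∈ s) :
    Sigma.ι X i ≫ sigmaTrunc X s = Sigma.ι X i := by
  simp [sigmaTrunc, hi]

lemma ι_sigmaTrunc_of_notMem {s : Finset I} {i : I} (hi : i ∉ s) :
    Sigma.ι X i ≫ sigmaTrunc X s = 0 := by
  simp [sigmaTrunc, hi]

lemma sigmaTrunc_comp_of_subset {s t : Finset I} (h : s ⊆ t) :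
    sigmaTrunc X s ≫ sigmaTrunc X t = sigmaTrunc X s := by
  refine Sigma.hom_ext _ _ fun i => ?_
  by_cases hi : i ∈ s
  · rw [← Category.assoc, ι_sigmaTrunc_of_mem X hi, ι_sigmaTrunc_of_mem X (h hi)]
  · rw [← Category.assoc, ι_sigmaTrunc_of_notMem X hi, zero_comp]

lemma comp_sigmaTrunc_of_subset {C : T} {g : C ⟶ ∐ X} {s t : Finset I}
    (hg : g ≫ sigmaTrunc X s = g) (h : s ⊆ t) : g ≫ sigmaTrunc X t = g := by
  rw [← hg, Category.assoc, sigmaTrunc_comp_of_subset X h]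

lemma sigmaTrunc_eq_sum [DecidableEq I] (s : Finset I) :
    sigmaTrunc X s = ∑ i ∈ s, Sigma.π X i ≫ Sigma.ι X i := by
  refine Sigma.hom_ext _ _ fun j => ?_
  rw [Preadditive.comp_sum]
  by_cases hj : j ∈ s
  · rw [ι_sigmaTrunc_of_mem X hj, Finset.sum_eq_single_of_mem j hj]
    · simp
    · intro i _ hij
      rw [← Category.assoc, Sigma.ι_π_of_ne X hij.symm, zero_comp]
  · rw [ι_sigmaTrunc_of_notMem X hj, Finset.sum_eq_zero]
    intro i hi
    rw [← Category.assoc, Sigma.ι_π_of_ne X (by rintro rfl; exact hj hi), zero_comp]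

/-- The inclusion into `∐ X` of the finite coproduct of the summands indexed by `s`. -/
def sigmaIncl (s : Finset I) : ∐ (fun i : s => X i) ⟶ ∐ X :=
  Sigma.desc fun i => Sigma.ι X i

open Classical in
/-- The projection of `∐ X` onto the finite coproduct of the summands indexed by `s`. -/
def sigmaProj (s : Finset I) : ∐ X ⟶ ∐ (fun i : s => X i) :=
  Sigma.desc fun i => if h : i ∈ s then Sigma.ι (fun i : s => X i) ⟨i, h⟩ else 0

lemma sigmaProj_sigmaIncl (s : Finset I) : sigmaProj X s ≫ sigmaIncl X s = sigmaTrunc X s := by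
  refine Sigma.hom_ext _ _ fun i => ?_
  by_cases hi : i ∈ s <;> simp [sigmaIncl, sigmaProj, sigmaTrunc, hi]

end

/-- Injectivity of `⨁ i, Hom(C, X i) → Hom(C, ∐ X)` is automatic, because the projections onto the
summands exist; so `C` is compact iff every map to a coproduct factors through finitely many
summands. -/
lemma isCompactObj_iff {C : T} :
    IsCompactObj C ↔ ∀ (I : Type v) (X : I → T) (g : C ⟶ ∐ X),
      ∃ s : Finset I, g ≫ sigmaTrunc X s = g := by
  classical
  constructor
  · intro hC I X g
    obtain ⟨d, rfl⟩ := (hC I X).2 g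
    induction d using DirectSum.induction_on with
    | zero => exact ⟨∅, by simp⟩
    | of i x =>
      refine ⟨{i}, ?_⟩
      have h : x ≫ Sigma.ι X i ≫ sigmaTrunc X {i} = x ≫ Sigma.ι X i := by
        rw [ι_sigmaTrunc_of_mem X (Finset.mem_singleton_self i)]
      simpa [Preadditive.rightComp] using h
    | add d d' h h' =>
      obtain ⟨s, hs⟩ := h
      obtain ⟨t, ht⟩ := h'
      refine ⟨s ∪ t, ?_⟩
      rw [map_add, Preadditive.add_comp, comp_sigmaTrunc_of_subset X hs Finset.subset_union_left,
        comp_sigmaTrunc_of_subset X ht Finset.subset_union_right]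
  · intro H I X
    constructor
    · intro d d' h
      have key : ∀ (e : DirectSum I fun i => C ⟶ X i) (i : I),
          (DirectSum.toAddMonoid (fun i => Preadditive.rightComp C (Sigma.ι X i)) e :
            C ⟶ ∐ X) ≫ Sigma.π X i = e i := by
        intro e i
        induction e using DirectSum.induction_on with
        | zero => simp
        | of j x =>
          by_cases hij : j = i
          · subst hij
            simp [Preadditive.rightComp]
          · simp [Preadditive.rightComp, DirectSum.of_eq_of_ne _ _ _ (Ne.symm hij),
              Sigma.ι_π_of_ne X hij]
        | add e e' h h' => simp [Preadditive.add_comp, h, h']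
      refine DFinsupp.ext fun i => ?_
      rw [← key d i, ← key d' i]
      exact congrArg (· ≫ Sigma.π X i) h
    · intro g
      obtain ⟨s, hs⟩ := H I X g
      refine ⟨∑ i ∈ s, DirectSum.of (fun i => C ⟶ X i) i (g ≫ Sigma.π X i), ?_⟩
      rw [sigmaTrunc_eq_sum, Preadditive.comp_sum] at hs
      rw [map_sum]
      refine (Finset.sum_congr rfl fun i _ => ?_).trans hs
      simp [Preadditive.rightComp]

/-- Compactness also controls maps `C ⟶ F (∐ X)` for a coproduct-preserving `F`, such as a shift. -/
lemma IsCompactObj.exists_comp_map_sigmaTrunc {C : T} (hC : IsCompactObj C) (F : T ⥤ T)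
    [F.Additive] {I : Type v} [PreservesColimitsOfShape (Discrete I) F] (X : I → T)
    (g : C ⟶ F.obj (∐ X)) : ∃ s : Finset I, g ≫ F.map (sigmaTrunc X s) = g := by
  classical
  obtain ⟨s, hs⟩ := isCompactObj_iff.1 hC I (fun i => F.obj (X i))
    (g ≫ inv (sigmaComparison F X))
  have h : sigmaComparison F X ≫ F.map (sigmaTrunc X s) =
      sigmaTrunc (fun i => F.obj (X i)) s ≫ sigmaComparison F X := by
    refine Sigma.hom_ext _ _ fun i => ?_
    by_cases hi : i ∈ s
    · rw [← Category.assoc, ι_comp_sigmaComparison, ← Category.assoc, ι_sigmaTrunc_of_mem _ hi,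
        ι_comp_sigmaComparison, ← F.map_comp, ι_sigmaTrunc_of_mem _ hi]
    · rw [← Category.assoc, ι_comp_sigmaComparison, ← Category.assoc, ι_sigmaTrunc_of_notMem _ hi,
        zero_comp, ← F.map_comp, ι_sigmaTrunc_of_notMem _ hi, F.map_zero]
  refine ⟨s, ?_⟩
  calc g ≫ F.map (sigmaTrunc X s)
      = (g ≫ inv (sigmaComparison F X)) ≫ sigmaComparison F X ≫ F.map (sigmaTrunc X s) := by simp
    _ = ((g ≫ inv (sigmaComparison F X)) ≫ sigmaTrunc (fun i => F.obj (X i)) s) ≫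
          sigmaComparison F X := by rw [h]; simp only [Category.assoc]
    _ = g := by rw [hs]; simp

lemma IsCompactObj.of_isZero {C : T} (hC : IsZero C) : IsCompactObj C :=
  isCompactObj_iff.2 fun _ _ _ => ⟨∅, hC.eq_of_src _ _⟩

instance : (IsCompactObj (T := T)).IsClosedUnderIsomorphisms where
  of_iso e h := isCompactObj_iff.2 fun I X g => by
    obtain ⟨s, hs⟩ := isCompactObj_iff.1 h I X (e.hom ≫ g)
    exact ⟨s, by rw [← cancel_epi e.hom, ← Category.assoc, hs]⟩

variable [HasShift T ℤ] [∀ n : ℤ, (shiftFunctor T n).Additive]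

lemma IsCompactObj.shift {C : T} (hC : IsCompactObj C) (n : ℤ) : IsCompactObj (C⟦n⟧) :=
  isCompactObj_iff.2 fun I X g => by
    let e := (shiftEquiv T n).toAdjunction
    obtain ⟨s, hs⟩ := hC.exists_comp_map_sigmaTrunc (shiftFunctor T (-n)) X (e.homEquiv _ _ g)
    refine ⟨s, (e.homEquiv _ _).injective ?_⟩
    exact (e.homEquiv_naturality_right _ _).trans hs

variable [HasZeroObject T] [Pretriangulated T]

lemma IsCompactObj.of_distTriang {t : Triangle T} (ht : t ∈ distTriang T)
    (h₁ : IsCompactObj t.obj₁) (h₃ : IsCompactObj t.obj₃) : IsCompactObj t.obj₂ := by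
  classical
  -- the part of `g` outside finitely many summands descends to `t.obj₃`
  refine isCompactObj_iff.2 fun I X g => ?_
  obtain ⟨s, hs⟩ := isCompactObj_iff.1 h₁ I X (t.mor₁ ≫ g)
  obtain ⟨k, hk⟩ := t.yoneda_exact₂ ht (g - g ≫ sigmaTrunc X s) (by
    rw [Preadditive.comp_sub, ← Category.assoc, hs, sub_self])
  obtain ⟨r, hr⟩ := isCompactObj_iff.1 h₃ I X k
  refine ⟨s ∪ r, ?_⟩
  have h₁' : (g ≫ sigmaTrunc X s) ≫ sigmaTrunc X (s ∪ r) = g ≫ sigmaTrunc X s := by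
    rw [Category.assoc, sigmaTrunc_comp_of_subset X Finset.subset_union_left]
  have h₂' : (g - g ≫ sigmaTrunc X s) ≫ sigmaTrunc X (s ∪ r) = g - g ≫ sigmaTrunc X s := by
    rw [hk, Category.assoc, comp_sigmaTrunc_of_subset X hr Finset.subset_union_right]
  calc g ≫ sigmaTrunc X (s ∪ r)
      = (g - g ≫ sigmaTrunc X s) ≫ sigmaTrunc X (s ∪ r) +
          (g ≫ sigmaTrunc X s) ≫ sigmaTrunc X (s ∪ r) := by
        rw [← Preadditive.add_comp, sub_add_cancel]
    _ = g := by rw [h₁', h₂', sub_add_cancel]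

end Compact

/-! ### Exactness of distinguished triangles -/

section Triangle

variable {T : Type u} [Category.{v} T] [Preadditive T] [HasShift T ℤ]
  [∀ n : ℤ, (shiftFunctor T n).Additive] {X Y Z : T}

/-- The map `X⟦-1⟧ ⟶ Y` that corresponds to `g : X ⟶ Y⟦1⟧`. -/
def unshiftHom (g : X ⟶ Y⟦(1 : ℤ)⟧) : X⟦(-1 : ℤ)⟧ ⟶ Y :=
  g⟦(-1 : ℤ)⟧' ≫ (shiftFunctorCompIsoId T (1 : ℤ) (-1) (add_neg_cancel 1)).hom.app Y

/-- Vanishing of a composite with `f⟦1⟧'` can be tested after desuspension. -/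
lemma comp_shift_map_eq_zero_iff (g : X ⟶ Y⟦(1 : ℤ)⟧) (f : Y ⟶ Z) :
    g ≫ f⟦(1 : ℤ)⟧' = 0 ↔ unshiftHom g ≫ f = 0 := by
  have key : (g ≫ f⟦(1 : ℤ)⟧')⟦(-1 : ℤ)⟧' = (unshiftHom g ≫ f) ≫
      (shiftFunctorCompIsoId T (1 : ℤ) (-1) (add_neg_cancel 1)).inv.app Z := by
    simp only [Functor.map_comp, shift_shift_neg', unshiftHom, Category.assoc]
  rw [← (shiftFunctor T (-1 : ℤ)).map_eq_zero_iff, key]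
  constructor
  · intro h
    rw [← cancel_mono ((shiftFunctorCompIsoId T (1 : ℤ) (-1) (add_neg_cancel 1)).inv.app Z), h,
      zero_comp]
  · intro h
    rw [h, zero_comp]

lemma unshiftHom_eq_zero_iff (g : X ⟶ Y⟦(1 : ℤ)⟧) : unshiftHom g = 0 ↔ g = 0 := by
  simpa using (comp_shift_map_eq_zero_iff g (𝟙 Y)).symm

variable [HasZeroObject T] [Pretriangulated T] {f : X ⟶ Y} {g : Y ⟶ Z} {h : Z ⟶ X⟦(1 : ℤ)⟧}

lemma mor₁_comp_mor₂ (ht : Triangle.mk f g h ∈ distTriang T) : f ≫ g = 0 :=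
  comp_distTriang_mor_zero₁₂ _ ht

lemma mor₂_comp_mor₃ (ht : Triangle.mk f g h ∈ distTriang T) : g ≫ h = 0 :=
  comp_distTriang_mor_zero₂₃ _ ht

lemma exists_lift_mor₁ (ht : Triangle.mk f g h ∈ distTriang T) {W : T} {k : W ⟶ Y}
    (hk : k ≫ g = 0) : ∃ l : W ⟶ X, k = l ≫ f :=
  Triangle.coyoneda_exact₂ _ ht k hk

lemma exists_lift_mor₂ (ht : Triangle.mk f g h ∈ distTriang T) {W : T} {k : W ⟶ Z}
    (hk : k ≫ h = 0) : ∃ l : W ⟶ Y, k = l ≫ g :=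
  Triangle.coyoneda_exact₃ _ ht k hk

lemma exists_desc_mor₂ (ht : Triangle.mk f g h ∈ distTriang T) {W : T} {k : Y ⟶ W}
    (hk : f ≫ k = 0) : ∃ l : Z ⟶ W, k = g ≫ l :=
  Triangle.yoneda_exact₂ _ ht k hk

end Triangle

/-! ### Phantom maps -/

section Phantom

variable {T : Type u} [Category.{v} T] [Preadditive T] [HasCoproducts.{v} T]
  [HasZeroObject T] [HasShift T ℤ] [∀ n : ℤ, (shiftFunctor T n).Additive] [Pretriangulated T]

/-- A map into a pure injective object that is zero on compact objects (a phantom map) is zero: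
the second map of the triangle it spans is a pure monomorphism, hence split. -/
lemma IsPureInjective.eq_zero_of_phantom {Z Q : T} (hQ : IsPureInjective Q) (f : Z ⟶ Q)
    (hf : ∀ (C : T), IsCompactObj C → ∀ g : C ⟶ Z, g ≫ f = 0) : f = 0 := by
  obtain ⟨K, a, b, ht⟩ := distinguished_cocone_triangle f
  have ht' : Triangle.mk a b (-f⟦(1 : ℤ)⟧') ∈ distTriang T := rot_of_distTriang _ ht
  have hf' : ∀ (C : T), IsCompactObj C → ∀ g : C ⟶ Z⟦(1 : ℤ)⟧, g ≫ f⟦(1 : ℤ)⟧' = 0 := by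
    intro C hC g
    exact (comp_shift_map_eq_zero_iff g f).2 (hf _ (hC.shift (-1)) _)
  have ha : IsPureMono a := by
    refine ⟨_, b, -f⟦(1 : ℤ)⟧', ht', ?_, ?_, ?_⟩
    · intro C hC (g : C ⟶ Q) (g' : C ⟶ Q) (h : g ≫ a = g' ≫ a)
      have h0 : (g - g') ≫ a = 0 := by rw [Preadditive.sub_comp, h, sub_self]
      obtain ⟨k, hk⟩ := exists_lift_mor₁ ht h0
      exact sub_eq_zero.1 (hk.trans (hf C hC k))
    · intro C hC (g : C ⟶ K)
      constructor
      · intro h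
        obtain ⟨k, hk⟩ := exists_lift_mor₁ ht' h
        exact ⟨k, hk.symm⟩
      · rintro ⟨k : C ⟶ Q, rfl⟩
        have h : (k ≫ a) ≫ b = 0 := by rw [Category.assoc, mor₁_comp_mor₂ ht', comp_zero]
        exact h
    · intro C hC (g : C ⟶ Z⟦(1 : ℤ)⟧)
      have h0 : g ≫ (-f⟦(1 : ℤ)⟧') = 0 := by rw [Preadditive.comp_neg, hf' C hC g, neg_zero]
      obtain ⟨k, hk⟩ := exists_lift_mor₂ ht' h0
      exact ⟨k, hk.symm⟩
  have := hQ a ha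
  rw [← cancel_mono a, zero_comp]
  exact comp_distTriang_mor_zero₁₂ _ ht

end Phantom

/-! ### The closure of a small class under extensions -/

section ExtensionClosure

open ObjectProperty

variable {T : Type u} [Category.{v} T] [Preadditive T] [HasZeroObject T] [HasShift T ℤ]
  [∀ n : ℤ, (shiftFunctor T n).Additive] [Pretriangulated T]

instance essentiallySmall_extensionProduct (P Q : ObjectProperty T)
    [ObjectProperty.EssentiallySmall.{v} P] [ObjectProperty.EssentiallySmall.{v} Q] :
    ObjectProperty.EssentiallySmall.{v} (extensionProduct P Q) := by
  obtain ⟨P', _, hP, hP'⟩ := EssentiallySmall.exists_small_le.{v} P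
  obtain ⟨Q', _, hQ, hQ'⟩ := EssentiallySmall.exists_small_le.{v} Q
  -- one chosen extension for each `h : Z ⟶ Y⟦1⟧` with `Y` in `P'` and `Z` in `Q'`
  let E : (Σ (Y : Subtype P') (Z : Subtype Q'), (Z.1 ⟶ Y.1⟦(1 : ℤ)⟧)) → T := fun x =>
    (distinguished_cocone_triangle₂ x.2.2).choose
  refine ⟨ofObj E, inferInstance, ?_⟩
  rintro X hX
  have hX' : extensionProduct P' Q' X := by
    rw [← extensionProduct_isoClosure_left, ← extensionProduct_isoClosure_right]
    exact monotone_extensionProduct_left _ hP' _ (monotone_extensionProduct_right _ hQ' _ hX)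
  obtain ⟨Y, Z, f, g, h, ht, hY, hZ⟩ := hX'
  obtain ⟨f', g', ht'⟩ := (distinguished_cocone_triangle₂ h).choose_spec
  exact ⟨E ⟨⟨Y, hY⟩, ⟨Z, hZ⟩, h⟩, ofObj_apply _ _, ⟨Triangle.π₂.mapIso
    (isoTriangleOfIso₁₃ _ _ ht ht' (Iso.refl _) (Iso.refl _)
      (show h ≫ (𝟙 Y)⟦(1 : ℤ)⟧' = 𝟙 Z ≫ h by simp))⟩⟩

/-- The `n`-th step in closing `P` under extensions and isomorphisms. -/
def extensionStep (P : ObjectProperty T) : ℕ → ObjectProperty T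
  | 0 => P.isoClosure
  | n + 1 => extensionStep P n ⊔ extensionProduct (extensionStep P n) (extensionStep P n)

/-- The closure of `P` under extensions and isomorphisms. -/
def extensionClosure (P : ObjectProperty T) : ObjectProperty T := ⨆ n, extensionStep P n

variable (P : ObjectProperty T)

lemma monotone_extensionStep : Monotone (extensionStep P) :=
  monotone_nat_of_le_succ fun _ => le_sup_left

lemma le_extensionClosure : P ≤ extensionClosure P :=
  P.le_isoClosure.trans (le_iSup (extensionStep P) 0)

instance isClosedUnderIsomorphisms_extensionStep (n : ℕ) :
    (extensionStep P n).IsClosedUnderIsomorphisms := by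
  induction n with
  | zero => exact inferInstanceAs P.isoClosure.IsClosedUnderIsomorphisms
  | succ n ih =>
    refine ⟨fun e h => ?_⟩
    rcases h with h | h
    · exact Or.inl (prop_of_iso _ e h)
    · exact Or.inr (prop_of_iso _ e h)

instance essentiallySmall_extensionStep [ObjectProperty.EssentiallySmall.{v} P] (n : ℕ) :
    ObjectProperty.EssentiallySmall.{v} (extensionStep P n) := by
  induction n with
  | zero => exact inferInstanceAs (ObjectProperty.EssentiallySmall.{v} P.isoClosure)
  | succ n ih =>
    exact inferInstanceAs (ObjectProperty.EssentiallySmall.{v}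
      (extensionStep P n ⊔ extensionProduct (extensionStep P n) (extensionStep P n)))

instance essentiallySmall_extensionClosure [ObjectProperty.EssentiallySmall.{v} P] :
    ObjectProperty.EssentiallySmall.{v} (extensionClosure P) :=
  inferInstanceAs (ObjectProperty.EssentiallySmall.{v} (⨆ n, extensionStep P n))

lemma extensionClosure_iff (X : T) : extensionClosure P X ↔ ∃ n, extensionStep P n X :=
  prop_iSup_iff _ X

instance : (extensionClosure P).IsClosedUnderIsomorphisms where
  of_iso e h := by
    rw [extensionClosure_iff] at h ⊢
    obtain ⟨n, hn⟩ := h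
    exact ⟨n, prop_of_iso _ e hn⟩

instance : (extensionClosure P).IsTriangulatedClosed₂ := by
  apply IsTriangulatedClosed₂.mk'
  intro t ht h₁ h₃
  rw [extensionClosure_iff] at h₁ h₃ ⊢
  obtain ⟨n, hn⟩ := h₁
  obtain ⟨m, hm⟩ := h₃
  exact ⟨max n m + 1, Or.inr ⟨_, _, _, _, _, ht,
    monotone_extensionStep P (le_max_left n m) _ hn,
    monotone_extensionStep P (le_max_right n m) _ hm⟩⟩

variable {P} in
lemma extensionClosure_le {Q : ObjectProperty T} [Q.IsClosedUnderIsomorphisms]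
    [Q.IsTriangulatedClosed₂] (h : P ≤ Q) : extensionClosure P ≤ Q := by
  refine iSup_le fun n => ?_
  induction n with
  | zero => exact (isoClosure_le_iff _ _).2 h
  | succ n ih => exact sup_le ih (extensionProduct_le_of_isTriangulatedClosed₂ ih ih)

lemma isClosedUnderFiniteCoproducts_of_isTriangulatedClosed₂ [P.IsClosedUnderIsomorphisms]
    [P.ContainsZero] [P.IsTriangulatedClosed₂] : P.IsClosedUnderFiniteCoproducts := by
  have : P.IsClosedUnderBinaryCoproducts :=
    { colimitsOfShape_le := by
        rintro X ⟨p⟩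
        refine P.prop_of_iso ?_ (P.ext_of_isTriangulatedClosed₂ _
          (binaryBiproductTriangle_distinguished _ _)
          (p.prop_diag_obj (.mk .left)) (p.prop_diag_obj (.mk .right)))
        exact IsColimit.coconePointUniqueUpToIso (BinaryBiproduct.isColimit _ _)
          ((IsColimit.precomposeHomEquiv (diagramIsoPair p.diag).symm _).2 p.isColimit) }
  exact .mk'

end ExtensionClosure

/-! ### Towers of cones on coproducts -/

section Towers

variable {T : Type u} [Category.{v} T] [Preadditive T] [HasCoproducts.{v} T]

/-- A map from a compact object to a coproduct of objects of `P` factors through an object of `P`,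
if `P` is closed under finite coproducts. -/
lemma IsCompactObj.exists_factor_sigma {P : ObjectProperty T} [P.IsClosedUnderFiniteCoproducts]
    {C : T} (hC : IsCompactObj C) {I : Type v} {W : I → T} (hW : ∀ i, P (W i)) (g : C ⟶ ∐ W) :
    ∃ (S : T) (_ : P S) (a : C ⟶ S) (b : S ⟶ ∐ W), g = a ≫ b := by
  obtain ⟨s, hs⟩ := isCompactObj_iff.1 hC I W g
  refine ⟨∐ (fun i : s => W i), P.prop_coproduct fun i => hW i, g ≫ sigmaProj W s,
    sigmaIncl W s, ?_⟩
  rw [Category.assoc, sigmaProj_sigmaIncl, hs]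

/-- The property of a map `k : Z ⟶ Z'` that every map `C ⟶ Z` with `C` compact that is killed
by `k` factors through an object of `P`. -/
def KernelFactors (P : ObjectProperty T) {Z Z' : T} (k : Z ⟶ Z') : Prop :=
  ∀ (C : T), IsCompactObj C → ∀ f : C ⟶ Z, f ≫ k = 0 →
    ∃ (S : T) (_ : P S) (a : C ⟶ S) (b : S ⟶ Z), f = a ≫ b

lemma kernelFactors_id {P : ObjectProperty T} [P.IsClosedUnderIsomorphisms]
    [P.ContainsZero] {Z : T} : KernelFactors P (𝟙 Z) := by
  intro C _ f hf
  obtain ⟨S, hS, hS'⟩ := P.exists_prop_of_containsZero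
  exact ⟨S, hS', 0, 0, by simpa using hf⟩

variable [HasZeroObject T] [HasShift T ℤ] [∀ n : ℤ, (shiftFunctor T n).Additive]
  [Pretriangulated T]

/-- `j` is the cone inclusion of a map from a coproduct of objects of `P`. -/
def IsCellAttachment (P : ObjectProperty T) {Z Z' : T} (j : Z ⟶ Z') : Prop :=
  ∃ (I : Type v) (W : I → T) (_ : ∀ i, P (W i)) (w : ∐ W ⟶ Z) (d : Z' ⟶ (∐ W)⟦(1 : ℤ)⟧),
    Triangle.mk w j d ∈ distTriang T

/-- A map `f : C ⟶ Z` killed by `j ≫ k` has `f ≫ j` factoring through an object `S'` of `P`. Pulling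
the obstruction back to finitely many cells gives an extension `S` of `S'` by these cells and a map
`C ⟶ S ⟶ Z` that agrees with `f` up to a map factoring through finitely many further cells. -/
lemma IsCellAttachment.kernelFactors_comp {P : ObjectProperty T} [P.IsClosedUnderIsomorphisms]
    [P.ContainsZero] [P.IsTriangulatedClosed₂] (hP : P ≤ IsCompactObj) {Z Z' Z'' : T}
    {j : Z ⟶ Z'} {k : Z' ⟶ Z''} (hj : IsCellAttachment P j) (hk : KernelFactors P k) :
    KernelFactors P (j ≫ k) := by
  have := isClosedUnderFiniteCoproducts_of_isTriangulatedClosed₂ P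
  obtain ⟨I, W, hW, w, d, ht⟩ := hj
  intro C hC f hf
  obtain ⟨S', hS', a, b, hab⟩ := hk C hC (f ≫ j) (by rw [Category.assoc, hf])
  -- the obstruction `b ≫ d` to lifting `b` along `j` factors through finitely many cells
  obtain ⟨s, hs⟩ := (hP _ hS').exists_comp_map_sigmaTrunc (shiftFunctor T (1 : ℤ)) W (b ≫ d)
  rw [← sigmaProj_sigmaIncl, Functor.map_comp, ← Category.assoc] at hs
  obtain ⟨S, m, p, ht'⟩ := distinguished_cocone_triangle₂ ((b ≫ d) ≫ (sigmaProj W s)⟦(1 : ℤ)⟧')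
  have hS : P S := P.ext_of_isTriangulatedClosed₂ _ ht' (P.prop_coproduct fun i => hW i) hS'
  obtain ⟨a', ha'⟩ := exists_lift_mor₂ ht' (k := a) (by
    have h0 : a ≫ b ≫ d = 0 := by
      rw [← Category.assoc, ← hab, Category.assoc, mor₂_comp_mor₃ ht, comp_zero]
    rw [← Category.assoc, h0, zero_comp])
  obtain ⟨c, hc⟩ := exists_lift_mor₂ ht (k := p ≫ b) (by
    rw [Category.assoc, ← hs, ← Category.assoc, mor₂_comp_mor₃ ht', zero_comp])
  obtain ⟨e, he⟩ := exists_lift_mor₁ ht (k := f - a' ≫ c) (by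
    rw [Preadditive.sub_comp, hab, Category.assoc, ← hc, ← Category.assoc, ← ha', sub_self])
  obtain ⟨R, hR, x, y, hxy⟩ := hC.exists_factor_sigma hW e
  refine ⟨S ⊞ R, P.ext_of_isTriangulatedClosed₂ _ (binaryBiproductTriangle_distinguished S R) hS hR,
    biprod.lift a' x, biprod.desc c (y ≫ w), ?_⟩
  rw [biprod.lift_desc, ← Category.assoc, ← hxy, ← he, add_sub_cancel]

/-- Coning off all maps to `Z` from an essentially small class `P` kills these maps. -/
lemma exists_cellAttachment (P : ObjectProperty T) [ObjectProperty.EssentiallySmall.{v} P]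
    (Z : T) : ∃ (Z' : T) (j : Z ⟶ Z'), IsCellAttachment P j ∧
      ∀ S, P S → ∀ f : S ⟶ Z, f ≫ j = 0 := by
  obtain ⟨P', _, hP', hP''⟩ := ObjectProperty.EssentiallySmall.exists_small_le.{v} P
  let W : (Σ S : Shrink.{v} (Subtype P'), (((equivShrink _).symm S).1 ⟶ Z)) → T := fun x =>
    ((equivShrink _).symm x.1).1
  let w : ∐ W ⟶ Z := Sigma.desc fun x => x.2
  obtain ⟨Z', j, d, ht⟩ := distinguished_cocone_triangle w
  refine ⟨Z', j, ⟨_, W, fun x => hP' _ ((equivShrink _).symm x.1).2, w, d, ht⟩, ?_⟩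
  intro S hS f
  obtain ⟨S', hS', ⟨e⟩⟩ := hP'' S hS
  have h : ∀ (A : Subtype P') (g : A.1 ⟶ Z), g ≫ j = 0 := by
    intro A g
    obtain ⟨x, rfl⟩ := (equivShrink (Subtype P')).symm.surjective A
    have hg : g = Sigma.ι W ⟨x, g⟩ ≫ w := by simp [w]
    rw [hg, Category.assoc, mor₁_comp_mor₂ ht, comp_zero]
  rw [← cancel_epi e.inv, ← Category.assoc, h ⟨S', hS'⟩, comp_zero]

end Towers

/-! ### The telescope of a sequence -/

section Telescope

variable {T : Type u} [Category.{v} T] [Preadditive T] [HasCoproducts.{v} T]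
  (Z : ℕ → T) (j : ∀ n, Z n ⟶ Z (n + 1))

/-- The endomorphism of `∐ Z` induced by the transition maps of the sequence `Z`. The index set
`ℕ` is lifted to the universe of the coproducts. -/
def telescopeShift : ∐ (fun n : ULift.{v} ℕ => Z n.down) ⟶ ∐ (fun n : ULift.{v} ℕ => Z n.down) :=
  Sigma.desc fun n => j n.down ≫ Sigma.ι (fun n : ULift.{v} ℕ => Z n.down) ⟨n.down + 1⟩

lemma telescopeShift_π_zero :
    telescopeShift Z j ≫ Sigma.π (fun n : ULift.{v} ℕ => Z n.down) ⟨0⟩ = 0 := by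
  refine Sigma.hom_ext _ _ fun n => ?_
  have h : (⟨n.down + 1⟩ : ULift.{v} ℕ) ≠ ⟨0⟩ := by simp
  simp [telescopeShift, Sigma.ι_π_of_ne (fun n : ULift.{v} ℕ => Z n.down) h]

lemma telescopeShift_π_succ (n : ℕ) :
    telescopeShift Z j ≫ Sigma.π (fun n : ULift.{v} ℕ => Z n.down) ⟨n + 1⟩ =
      Sigma.π (fun n : ULift.{v} ℕ => Z n.down) ⟨n⟩ ≫ j n := by
  refine Sigma.hom_ext _ _ fun m => ?_
  obtain ⟨m⟩ := m
  by_cases hm : m = n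
  · subst hm
    simp [telescopeShift]
  · have h : (⟨m + 1⟩ : ULift.{v} ℕ) ≠ ⟨n + 1⟩ := by simpa using hm
    have h' : (⟨m⟩ : ULift.{v} ℕ) ≠ ⟨n⟩ := by simpa using hm
    have h₁ := Sigma.ι_π_of_ne (fun n : ULift.{v} ℕ => Z n.down) h
    have h₂ := Sigma.ι_π_of_ne (fun n : ULift.{v} ℕ => Z n.down) h'
    rw [← Category.assoc _ _ (j n), h₂, zero_comp]
    simp [telescopeShift, h₁]

/-- If `1 - shift` is an isomorphism, then the homotopy colimit of the sequence vanishes, and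
hence, if `Z 0` is compact, the transition map `Z 0 ⟶ Z n` vanishes for some `n`. -/
lemma exists_map_eq_zero_of_isIso_telescope [IsIso (𝟙 _ - telescopeShift Z j)]
    (hZ : IsCompactObj (Z 0)) :
    ∃ n : ℕ, (Functor.ofSequence j).map (homOfLE (Nat.zero_le n)) = 0 := by
  let W := fun n : ULift.{v} ℕ => Z n.down
  let x : Z 0 ⟶ ∐ W := Sigma.ι W ⟨0⟩ ≫ inv (𝟙 _ - telescopeShift Z j)
  have hx : x = Sigma.ι W ⟨0⟩ + x ≫ telescopeShift Z j := by
    have h : x ≫ (𝟙 _ - telescopeShift Z j) = Sigma.ι W ⟨0⟩ := by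
      rw [Category.assoc, IsIso.inv_hom_id, Category.comp_id]
    rw [Preadditive.comp_sub, Category.comp_id] at h
    rw [← h, sub_add_cancel]
  -- the components of `x = ι₀ + x ≫ shift` are the transition maps `Z 0 ⟶ Z n`
  have hπ : ∀ n : ℕ, x ≫ Sigma.π W ⟨n⟩ =
      (Functor.ofSequence j).map (homOfLE (Nat.zero_le n)) := by
    intro n
    induction n with
    | zero =>
      rw [hx, Preadditive.add_comp, Category.assoc, telescopeShift_π_zero, comp_zero, add_zero,
        Sigma.ι_π_eq_id]
      exact ((Functor.ofSequence j).map_id 0).symm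
    | succ n ih =>
      have h : (⟨0⟩ : ULift.{v} ℕ) ≠ ⟨n + 1⟩ := by simp
      rw [hx, Preadditive.add_comp, Category.assoc, telescopeShift_π_succ,
        Sigma.ι_π_of_ne W h, zero_add, ← Category.assoc, ih]
      have h' : homOfLE (Nat.zero_le (n + 1)) =
        homOfLE (Nat.zero_le n) ≫ homOfLE (Nat.le_add_right n 1) := rfl
      rw [h', Functor.map_comp, Functor.ofSequence_map_homOfLE_succ]
      rfl
  obtain ⟨s, hs⟩ := isCompactObj_iff.1 hZ _ W x
  obtain ⟨n, hn⟩ := Infinite.exists_notMem_finset s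
  refine ⟨n.down, ?_⟩
  rw [← hπ, ← hs, Category.assoc]
  suffices h : sigmaTrunc W s ≫ Sigma.π W n = 0 by rw [h, comp_zero]; rfl
  refine Sigma.hom_ext _ _ fun i => ?_
  by_cases hi : i ∈ s
  · rw [← Category.assoc, ι_sigmaTrunc_of_mem W hi, comp_zero,
      Sigma.ι_π_of_ne W (by rintro rfl; exact hn hi)]
  · rw [← Category.assoc, ι_sigmaTrunc_of_notMem W hi, zero_comp, comp_zero]

end Telescope

/-! ### Compact objects are generated by a small family -/

section Generation

open ZeroObject

variable {T : Type u} [Category.{v} T] [Preadditive T] [HasCoproducts.{v} T]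
  [HasZeroObject T] [HasShift T ℤ] [∀ n : ℤ, (shiftFunctor T n).Additive] [Pretriangulated T]

instance : (IsCompactObj (T := T)).IsTriangulatedClosed₂ :=
  .mk' fun _ ht h₁ h₃ => IsCompactObj.of_distTriang ht h₁ h₃

/-- If the transition maps of the sequence `Z` kill all maps from a shift-stable class `R` of
compact generators, then `1 - shift` is an isomorphism on `∐ Z`. -/
lemma isIso_telescope {R : ObjectProperty T} [R.IsStableUnderShift ℤ]
    (hR : R ≤ IsCompactObj) (hR' : ∀ X : T, (∀ S, R S → ∀ f : S ⟶ X, f = 0) → IsZero X)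
    (Z : ℕ → T) (j : ∀ n, Z n ⟶ Z (n + 1))
    (hj : ∀ (n : ℕ) (S : T), R S → ∀ f : S ⟶ Z n, f ≫ j n = 0) :
    IsIso (𝟙 _ - telescopeShift Z j) := by
  let W := fun n : ULift.{v} ℕ => Z n.down
  have h₀ : ∀ S, R S → ∀ x : S ⟶ ∐ W, x ≫ telescopeShift Z j = 0 := by
    intro S hS x
    obtain ⟨s, hs⟩ := isCompactObj_iff.1 (hR _ hS) _ W x
    rw [← hs, sigmaTrunc_eq_sum, Preadditive.comp_sum, Preadditive.sum_comp]
    refine Finset.sum_eq_zero fun n _ => ?_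
    have h : Sigma.ι W n ≫ telescopeShift Z j = j n.down ≫ Sigma.ι W ⟨n.down + 1⟩ := by
      simp [telescopeShift, W]
    rw [Category.assoc, Category.assoc, h, ← Category.assoc, ← Category.assoc,
      Category.assoc x, ← Category.assoc x, hj _ _ hS, zero_comp]
  -- so `1 - shift` acts as the identity on maps from `R`, and its cone receives none but zero
  have h₁ : ∀ S, R S → ∀ x : S ⟶ ∐ W, x ≫ (𝟙 _ - telescopeShift Z j) = x := by
    intro S hS x
    rw [Preadditive.comp_sub, h₀ S hS, Category.comp_id, sub_zero]
  obtain ⟨H, q, d, ht⟩ := distinguished_cocone_triangle (𝟙 _ - telescopeShift Z j)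
  have hH : IsZero H := hR' _ fun S hS g => by
    have hd : g ≫ d = 0 := by
      have h : (g ≫ d) ≫ (𝟙 _ - telescopeShift Z j)⟦(1 : ℤ)⟧' = 0 := by
        have h' := comp_distTriang_mor_zero₃₁ _ ht
        rw [Category.assoc]
        exact (congrArg (g ≫ ·) h').trans comp_zero
      rw [comp_shift_map_eq_zero_iff, h₁ _ (R.le_shift (-1 : ℤ) _ hS)] at h
      exact (unshiftHom_eq_zero_iff _).1 h
    obtain ⟨x, rfl⟩ := exists_lift_mor₂ ht hd
    rw [← h₁ S hS x, Category.assoc, mor₁_comp_mor₂ ht, comp_zero]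
  exact (Triangle.isZero₃_iff_isIso₁ _ ht).1 hH

/-- Compact objects are retracts of iterated extensions of shifts of the compact generators. -/
lemma IsCompactObj.exists_retract_extensionClosure {R : ObjectProperty T}
    [R.IsStableUnderShift ℤ] [R.ContainsZero] [ObjectProperty.EssentiallySmall.{v} R]
    (hR : R ≤ IsCompactObj) (hR' : ∀ X : T, (∀ S, R S → ∀ f : S ⟶ X, f = 0) → IsZero X)
    {C : T} (hC : IsCompactObj C) :
    ∃ (S : T) (_ : extensionClosure R S), Nonempty (Retract C S) := by
  have hP : extensionClosure R ≤ IsCompactObj := extensionClosure_le hR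
  have : (extensionClosure R).ContainsZero := by
    obtain ⟨S, hS, hS'⟩ := R.exists_prop_of_containsZero
    exact ⟨S, hS, le_extensionClosure R _ hS'⟩
  choose next incl hincl hkill using exists_cellAttachment R
  let Z : ℕ → T := fun n => Nat.rec C (fun _ => next) n
  let j : ∀ n, Z n ⟶ Z (n + 1) := fun n => incl (Z n)
  have hj : ∀ n, IsCellAttachment (extensionClosure R) (j n) := fun n => by
    obtain ⟨I, W, hW, h⟩ := hincl (Z n)
    exact ⟨I, W, fun i => le_extensionClosure R _ (hW i), h⟩
  have key : ∀ (k m n : ℕ) (h : m + k = n), KernelFactors (extensionClosure R)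
      ((Functor.ofSequence j).map (homOfLE (Nat.le.intro h))) := by
    intro k
    induction k with
    | zero =>
      rintro m _ rfl
      have h : (Functor.ofSequence j).map (homOfLE (Nat.le.intro (Eq.refl (m + 0)))) = 𝟙 (Z m) :=
        (Functor.ofSequence j).map_id m
      rw [h]
      exact kernelFactors_id
    | succ k ih =>
      intro m n h
      have h' : homOfLE (Nat.le.intro h) =
        homOfLE (Nat.le_add_right m 1) ≫ homOfLE (Nat.le.intro (show m + 1 + k = n by lia)) := rfl
      rw [h', Functor.map_comp, Functor.ofSequence_map_homOfLE_succ]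
      exact (hj m).kernelFactors_comp hP (ih (m + 1) n (by lia))
  have := isIso_telescope hR hR' Z j fun n S hS f => hkill (Z n) S hS f
  obtain ⟨n, hn⟩ := exists_map_eq_zero_of_isIso_telescope Z j hC
  obtain ⟨S, hS, a, b, hab⟩ := key n 0 n (Nat.zero_add n) C hC (𝟙 C)
    ((congrArg (𝟙 C ≫ ·) hn).trans comp_zero)
  exact ⟨S, hS, ⟨a, b, hab.symm⟩⟩

/-- In a compactly generated triangulated category, there is a small family of compact objects of
which all compact objects are retracts. -/
lemma IsCompactlyGenerated.exists_small_retract (hT : IsCompactlyGenerated T) :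
    ∃ (P : ObjectProperty T) (_ : ObjectProperty.Small.{v} P), P ≤ IsCompactObj ∧
      ∀ C : T, IsCompactObj C → ∃ (S : T) (_ : P S), Nonempty (Retract C S) := by
  obtain ⟨G, hG, hGc, hGz⟩ := hT
  -- the shifts of the generators, together with a zero object
  let E : Unit ⊕ (G × ℤ) → T := Sum.elim (fun _ => 0) fun x => x.1.1⟦x.2⟧
  let R : ObjectProperty T := (ObjectProperty.ofObj E).isoClosure
  have hE : ∀ x, R (E x) := fun x =>
    ObjectProperty.le_isoClosure _ _ (ObjectProperty.ofObj_apply E x)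
  have hR : R ≤ IsCompactObj := by
    refine (ObjectProperty.isoClosure_le_iff _ _).2 ?_
    rintro _ ⟨_ | ⟨C, n⟩⟩
    · exact IsCompactObj.of_isZero (isZero_zero T)
    · exact (hGc C.1 C.2).shift n
  have hR' : ∀ X : T, (∀ S, R S → ∀ f : S ⟶ X, f = 0) → IsZero X := fun X hX =>
    (hGz X).2 fun C hC n f => hX _ (hE (.inr (⟨C, hC⟩, n))) f
  have : R.ContainsZero := ⟨0, isZero_zero T, hE (.inl ())⟩
  have : R.IsStableUnderShift ℤ := ⟨fun a => ObjectProperty.IsStableUnderShiftBy.mk (by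
    rintro X ⟨_, ⟨x⟩, ⟨e⟩⟩
    rw [ObjectProperty.prop_shift_iff]
    refine ObjectProperty.prop_of_iso R ((shiftFunctor T a).mapIso e.symm) ?_
    obtain _ | ⟨C, n⟩ := x
    · exact ObjectProperty.prop_of_iso R
        (IsZero.iso (isZero_zero T) ((shiftFunctor T a).map_isZero (isZero_zero T))) (hE (.inl ()))
    · exact ObjectProperty.prop_of_iso R ((shiftFunctorAdd T n a).app C.1)
        (hE (.inr (C, n + a))))⟩
  obtain ⟨P, _, hP, hP'⟩ :=
    ObjectProperty.EssentiallySmall.exists_small_le.{v} (extensionClosure R)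
  refine ⟨P, inferInstance, hP.trans (extensionClosure_le hR), fun C hC => ?_⟩
  obtain ⟨S, hS, ⟨r⟩⟩ := hC.exists_retract_extensionClosure hR hR'
  obtain ⟨S', hS', ⟨e⟩⟩ := hP' S hS
  exact ⟨S', hS', ⟨r.trans e.retract⟩⟩

end Generation

/-! ### The restricted Yoneda functor and pure injective objects -/

section Yoneda

variable {T : Type u} [Category.{v} T] [Preadditive T] [HasCoproducts.{v} T]

/-- The component at a compact object `C` of a morphism between restricted Yoneda functors, as a
homomorphism `Hom(C, Z) → Hom(C, Q)`. -/
def restrictedYonedaApp {Z Q : T}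
    (φ : (restrictedYoneda T).obj Z ⟶ (restrictedYoneda T).obj Q) (C : CompactObj T) :
    (C.obj ⟶ Z) →+ (C.obj ⟶ Q) :=
  (φ.hom.app (op C)).hom

lemma restrictedYonedaApp_comp {Z Q : T}
    (φ : (restrictedYoneda T).obj Z ⟶ (restrictedYoneda T).obj Q) {C C' : CompactObj T}
    (a : C ⟶ C') (g : C'.obj ⟶ Z) :
    restrictedYonedaApp φ C (a.hom ≫ g) = a.hom ≫ restrictedYonedaApp φ C' g :=
  ConcreteCategory.congr_hom (φ.hom.naturality a.op) g

lemma restrictedYoneda_hom_ext {Z Q : T}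
    {φ ψ : (restrictedYoneda T).obj Z ⟶ (restrictedYoneda T).obj Q}
    (h : ∀ (C : CompactObj T) (g : C.obj ⟶ Z),
      restrictedYonedaApp φ C g = restrictedYonedaApp ψ C g) : φ = ψ := by
  apply ObjectProperty.hom_ext
  ext C g
  exact h C.unop g

lemma restrictedYonedaApp_map {Z Q : T} (f : Z ⟶ Q) (C : CompactObj T) (g : C.obj ⟶ Z) :
    restrictedYonedaApp ((restrictedYoneda T).map f) C g = g ≫ f :=
  rfl

instance : (restrictedYoneda T).Additive where
  map_add := restrictedYoneda_hom_ext fun _ a => Preadditive.comp_add _ _ _ a _ _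

variable [HasZeroObject T] [HasShift T ℤ] [∀ n : ℤ, (shiftFunctor T n).Additive]
  [Pretriangulated T]

lemma IsPureInjective.restrictedYoneda_map_injective {Z Q : T} (hQ : IsPureInjective Q) :
    Function.Injective ((restrictedYoneda T).map : (Z ⟶ Q) → _) := by
  intro f g h
  rw [← sub_eq_zero]
  refine hQ.eq_zero_of_phantom _ fun C hC a => ?_
  have h' : a ≫ f = a ≫ g := congrArg (fun φ => restrictedYonedaApp φ ⟨C, hC⟩ a) h
  rw [Preadditive.comp_sub, h', sub_self]

/-- A morphism `φ : yZ ⟶ yQ` with `Q` pure injective comes from a map `Z ⟶ Q`. The map is first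
constructed on a coproduct of compact objects that covers `Z`; it descends to `Z` because the
fibre of the cover maps to `Q` by a phantom map. -/
lemma IsPureInjective.restrictedYoneda_map_surjective (hT : IsCompactlyGenerated T) {Z Q : T}
    (hQ : IsPureInjective Q) :
    Function.Surjective ((restrictedYoneda T).map : (Z ⟶ Q) → _) := by
  classical
  intro φ
  obtain ⟨P, _, hP, hP'⟩ := hT.exists_small_retract
  let A : Shrink.{v} (Subtype P) → CompactObj T := fun S =>
    ⟨((equivShrink (Subtype P)).symm S).1, hP _ ((equivShrink (Subtype P)).symm S).2⟩
  let W : (Σ S : Shrink.{v} (Subtype P), ((A S).obj ⟶ Z)) → T := fun x => (A x.1).obj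
  let p : ∐ W ⟶ Z := Sigma.desc fun x => x.2
  let w : ∐ W ⟶ Q := Sigma.desc fun x => restrictedYonedaApp φ (A x.1) x.2
  have hw : ∀ (C : CompactObj T) (g : C.obj ⟶ ∐ W),
      restrictedYonedaApp φ C (g ≫ p) = g ≫ w := by
    intro C g
    obtain ⟨s, hs⟩ := isCompactObj_iff.1 C.property _ W g
    rw [← hs, sigmaTrunc_eq_sum]
    simp only [Preadditive.comp_sum, Preadditive.sum_comp, map_sum]
    refine Finset.sum_congr rfl fun x _ => ?_
    have h₁ : Sigma.ι W x ≫ p = x.2 := by simp [p]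
    have h₂ : Sigma.ι W x ≫ w = restrictedYonedaApp φ (A x.1) x.2 := by simp [w]
    let a : C ⟶ A x.1 := ObjectProperty.homMk (g ≫ Sigma.π W x)
    have h := restrictedYonedaApp_comp φ a x.2
    calc restrictedYonedaApp φ C ((g ≫ Sigma.π W x ≫ Sigma.ι W x) ≫ p)
        = restrictedYonedaApp φ C ((g ≫ Sigma.π W x) ≫ x.2) := by
          simp only [Category.assoc, h₁]
      _ = (g ≫ Sigma.π W x) ≫ restrictedYonedaApp φ (A x.1) x.2 := h
      _ = (g ≫ Sigma.π W x ≫ Sigma.ι W x) ≫ w := by simp only [Category.assoc, h₂]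
  have hp : ∀ (C : CompactObj T) (g : C.obj ⟶ Z), ∃ g' : C.obj ⟶ ∐ W, g = g' ≫ p := by
    intro C g
    obtain ⟨S, hS, ⟨r⟩⟩ := hP' C.obj C.property
    have h : ∀ (B : Subtype P) (i : C.obj ⟶ B.1) (f : B.1 ⟶ Z),
        ∃ g' : C.obj ⟶ ∐ W, i ≫ f = g' ≫ p := by
      intro B i f
      obtain ⟨x, rfl⟩ := (equivShrink (Subtype P)).symm.surjective B
      refine ⟨i ≫ Sigma.ι W ⟨x, f⟩, ?_⟩
      have h₁ : Sigma.ι W ⟨x, f⟩ ≫ p = f := by simp [p]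
      rw [Category.assoc, h₁]
    obtain ⟨g', hg'⟩ := h ⟨S, hS⟩ r.i (r.r ≫ g)
    exact ⟨g', by rw [← hg', Retract.retract_assoc]⟩
  obtain ⟨K, k, d, ht⟩ := distinguished_cocone_triangle₁ p
  have hk : k ≫ w = 0 := hQ.eq_zero_of_phantom _ fun C hC g => by
    rw [← Category.assoc, ← hw ⟨C, hC⟩ (g ≫ k), Category.assoc, mor₁_comp_mor₂ ht, comp_zero,
      map_zero]
  obtain ⟨f, hf⟩ := exists_desc_mor₂ ht hk
  refine ⟨f, restrictedYoneda_hom_ext fun C g => ?_⟩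
  obtain ⟨g', rfl⟩ := hp C g
  rw [hw, hf, restrictedYonedaApp_map, Category.assoc]

end Yoneda

/-! ### The dual of a functor and its double dual -/

section NerveDual

variable {T : Type u₁} [Category.{v} T] [Preadditive T] [HasCoproducts.{v} T]
  {U : Type u₂} [Category.{v} U] [Preadditive U] [HasCoproducts.{v} U]
  (D : (CompactObj U)ᵒᵖ ⥤ CompactObj T) [D.Additive]
  (D' : (CompactObj T)ᵒᵖ ⥤ CompactObj U) [D'.Additive]

instance : (nerveDual D).Additive where
  map_add {F G f g} := by
    apply ObjectProperty.hom_ext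
    ext C χ
    refine AddMonoidHom.ext fun a => ?_
    let χ' : F.unop.obj.obj (op (D.obj (op C.unop))) →+ AddCircle (1 : ℚ) := χ
    exact χ'.map_add ((f.unop.hom.app _).hom a) ((g.unop.hom.app _).hom a)

/-- The evaluation map from a functor to its double dual, formed along a comparison
`D D' C ⟶ C`. -/
def toDoubleDual (ε : D'.rightOp ⋙ D ⟶ 𝟭 (CompactObj T)) (F : ModCompact T) :
    F ⟶ (nerveDual D').obj (op ((nerveDual D).obj (op F))) :=
  ObjectProperty.homMk
    { app := fun C => AddCommGrpCat.ofHom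
        ((AddMonoidHom.eval : _ →+ ((F.obj.obj (op (D.obj (op (D'.obj C)))) →+
          AddCircle (1 : ℚ)) →+ AddCircle (1 : ℚ))).comp (F.obj.map (ε.app C.unop).op).hom)
      naturality := by
        intro C C' f
        ext a
        refine AddMonoidHom.ext fun χ => ?_
        let χ' : F.obj.obj (op (D.obj (op (D'.obj C')))) →+ AddCircle (1 : ℚ) := χ
        have h : F.obj.map f ≫ F.obj.map (ε.app C'.unop).op = F.obj.map (ε.app C.unop).op ≫
            F.obj.map (D.map (D'.map f).op).op := by
          rw [← F.obj.map_comp, ← F.obj.map_comp, ← op_comp]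
          exact congrArg (fun x => F.obj.map (Quiver.Hom.op x)) (ε.naturality f.unop).symm
        exact congrArg χ' (ConcreteCategory.congr_hom h a) }

/-- A dual is a retract of its double dual: the evaluation map of `∂F` is split by the dual of the
evaluation map of `F`. -/
def retractNerveDual (ε : D'.rightOp ⋙ D ⟶ 𝟭 (CompactObj T))
    (ε' : D.rightOp ⋙ D' ⟶ 𝟭 (CompactObj U))
    (h : ∀ C : CompactObj U, D.map (ε'.app C).op ≫ ε.app (D.obj (op C)) = 𝟙 _)
    (F : ModCompact T) :
    Retract ((nerveDual D).obj (op F))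
      ((nerveDual D).obj (op ((nerveDual D').obj (op ((nerveDual D).obj (op F)))))) where
  i := toDoubleDual D' D ε' _
  r := (nerveDual D).map (toDoubleDual D D' ε F).op
  retract := by
    apply ObjectProperty.hom_ext
    ext C χ
    refine AddMonoidHom.ext fun a => ?_
    let χ' : F.obj.obj (op (D.obj (op C.unop))) →+ AddCircle (1 : ℚ) := χ
    have h' : F.obj.map (ε.app (D.obj C)).op ≫ F.obj.map (D.map (ε'.app C.unop).op).op = 𝟙 _ := by
      rw [← F.obj.map_comp, ← op_comp]
      exact (congrArg (fun x => F.obj.map (Quiver.Hom.op x)) (h C.unop)).trans (F.obj.map_id _)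
    exact congrArg χ' (ConcreteCategory.congr_hom h' a)

end NerveDual

/-- Precomposition with an isomorphism. -/
def precompAddEquiv {𝒞 : Type*} [Category* 𝒞] [Preadditive 𝒞] {A B : 𝒞} (e : A ≅ B) (Z : 𝒞) :
    (B ⟶ Z) ≃+ (A ⟶ Z) where
  toFun g := e.hom ≫ g
  invFun g := e.inv ≫ g
  left_inv g := e.inv_hom_id_assoc g
  right_inv g := e.hom_inv_id_assoc g
  map_add' g g' := Preadditive.comp_add _ _ _ e.hom g g'

/-! ### The duality of an AGJ triple -/

namespace AGJDualityTriple

variable {T : Type u₁} [Category.{v} T] [Preadditive T] [HasZeroObject T] [HasShift T ℤ]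
  [∀ n : ℤ, (shiftFunctor T n).Additive] [Pretriangulated T] [HasCoproducts.{v} T]
  {U : Type u₂} [Category.{v} U] [Preadditive U] [HasZeroObject U] [HasShift U ℤ]
  [∀ n : ℤ, (shiftFunctor U n).Additive] [Pretriangulated U] [HasCoproducts.{v} U]
  (S : AGJDualityTriple T U)

/-- The comparison `D D C ⟶ C` for `C` in `Tᶜ`. -/
def unitInv : S.D.rightOp ⋙ S.D' ⟶ 𝟭 (CompactObj T) where
  app C := S.e.unitInv.app C
  naturality _ _ f := S.e.unitInv.naturality f

/-- The comparison `D D C ⟶ C` for `C` in `Uᶜ`. -/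
def counitInv : S.D'.rightOp ⋙ S.D ⟶ 𝟭 (CompactObj U) where
  app C := (S.e.counitInv.app (op C)).unop
  naturality _ _ f := congrArg Quiver.Hom.unop (S.e.counitInv.naturality f.op).symm

/-- `∂F` is a retract of `∂∂∂F`, for `F` in `Mod Tᶜ`. -/
def retractPartialDual (F : ModCompact T) :
    Retract (S.partialDual.obj (op F))
      (S.partialDual.obj (op (S.partialDual'.obj (op (S.partialDual.obj (op F)))))) :=
  retractNerveDual S.D' S.D S.unitInv S.counitInv
    (fun C => S.e.inverse_counitInv_comp (op C)) F

/-- `∂G` is a retract of `∂∂∂G`, for `G` in `Mod Uᶜ`. -/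
def retractPartialDual' (G : ModCompact U) :
    Retract (S.partialDual'.obj (op G))
      (S.partialDual'.obj (op (S.partialDual.obj (op (S.partialDual'.obj (op G)))))) :=
  retractNerveDual S.D S.D' S.counitInv S.unitInv
    (fun C => congrArg Quiver.Hom.unop (S.e.counitInv_functor_comp C)) G

/-- `∂ (y X) ≅ y (Q X)`: at `C` this is `Hom(D C, X)⁺ ≅ Hom(D D C, Q X) ≅ Hom(C, Q X)`. -/
def partialDualYonedaIso (X : T) :
    S.partialDual.obj (op ((restrictedYoneda T).obj X)) ≅
      (restrictedYoneda U).obj (S.Q.obj (op X)) :=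
  ObjectProperty.isoMk _ (NatIso.ofComponents (fun C => AddEquiv.toAddCommGrpIso
    ((S.charIso (S.e.inverse.obj C) X).trans
      (precompAddEquiv ((IsCompactObj (T := U)).ι.mapIso (S.e.counitIso.app C).unop) _))) (by
    intro C C' f
    ext χ
    have h := S.charIso_natural_left (S.e.inverse.map f) X χ
    have h' : (S.e.counit.app C').unop.hom ≫ (S.e.functor.map (S.e.inverse.map f)).unop.hom =
        f.unop.hom ≫ (S.e.counit.app C).unop.hom :=
      congrArg (fun f => f.unop.hom) (S.e.counit.naturality f)
    exact (congrArg ((S.e.counit.app C').unop.hom ≫ ·) h).trans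
      ((Category.assoc _ _ _).symm.trans
        ((congrArg (· ≫ S.charIso (S.e.inverse.obj C) X χ) h').trans (Category.assoc _ _ _)))))

/-- `∂ (y Y) ≅ y (Q Y)`: at `C` this is `Hom(D C, Y)⁺ ≅ Hom(D D C, Q Y) ≅ Hom(C, Q Y)`. -/
def partialDualYonedaIso' (Y : U) :
    S.partialDual'.obj (op ((restrictedYoneda U).obj Y)) ≅
      (restrictedYoneda T).obj (S.Q'.obj (op Y)) :=
  ObjectProperty.isoMk _ (NatIso.ofComponents (fun C => AddEquiv.toAddCommGrpIso
    ((S.charIso' (S.D.obj C) Y).trans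
      (precompAddEquiv ((IsCompactObj (T := T)).ι.mapIso (S.e.unitIso.app C.unop)) _))) (by
    intro C C' f
    ext χ
    have h := S.charIso'_natural_left (S.D.map f) Y χ
    have h' : (S.e.unit.app C'.unop).hom ≫ (S.e.inverse.map (S.e.functor.map f.unop)).hom =
        f.unop.hom ≫ (S.e.unit.app C.unop).hom :=
      congrArg (fun f => f.hom) (S.e.unit.naturality f.unop).symm
    exact (congrArg ((S.e.unit.app C'.unop).hom ≫ ·) h).trans
      ((Category.assoc _ _ _).symm.trans
        ((congrArg (· ≫ S.charIso' (S.D.obj C) Y χ) h').trans (Category.assoc _ _ _)))))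

end AGJDualityTriple

/-! ### Classes of functors defined by retracts -/

section RetractClass

variable {𝒯 : Type*} [Category* 𝒯] {𝒞 : Type*} [Category* 𝒞]

/-- The objects `F` of `𝒞` such that `E F` is a retract of `y Z` for some `Z` in `X`. -/
def retractClass (E : 𝒞 ⥤ 𝒞) (y : 𝒯 ⥤ 𝒞) (X : ObjectProperty 𝒯) : ObjectProperty 𝒞 :=
  fun F => ∃ (Z : 𝒯) (_ : X Z), Nonempty (Retract (E.obj F) (y.obj Z))

variable (E : 𝒞 ⥤ 𝒞) (y : 𝒯 ⥤ 𝒞) (X : ObjectProperty 𝒯)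

lemma retractClass_isStableUnderRetracts : (retractClass E y X).IsStableUnderRetracts where
  of_retract := by
    rintro F F' r ⟨Z, hZ, ⟨s⟩⟩
    exact ⟨Z, hZ, ⟨(r.map E).trans s⟩⟩

/-- Additive functors turn a finite family of retractions into a retraction of direct sums. -/
def retractOfIsBilimit [Preadditive 𝒯] [HasFiniteBiproducts 𝒯] [Preadditive 𝒞] [E.Additive]
    [y.Additive] {J : Type} [Fintype J] {f : J → 𝒞} {b : Bicone f} (hb : b.IsBilimit) {Z : J → 𝒯}
    (r : ∀ j, Retract (E.obj (f j)) (y.obj (Z j))) : Retract (E.obj b.pt) (y.obj (⨁ Z)) where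
  i := ∑ j, E.map (b.π j) ≫ (r j).i ≫ y.map (biproduct.ι Z j)
  r := ∑ j, y.map (biproduct.π Z j) ≫ (r j).r ≫ E.map (b.ι j)
  retract := by
    classical
    have h : ∀ j k, (E.map (b.π j) ≫ (r j).i ≫ y.map (biproduct.ι Z j)) ≫
        y.map (biproduct.π Z k) ≫ (r k).r ≫ E.map (b.ι k) =
          if j = k then E.map (b.π j ≫ b.ι j) else 0 := by
      intro j k
      split_ifs with hjk
      · subst hjk
        simp [← Functor.map_comp_assoc]
      · have h0 : y.map (biproduct.ι Z j) ≫ y.map (biproduct.π Z k) = 0 := by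
          rw [← y.map_comp, biproduct.ι_π_ne Z hjk, y.map_zero]
        simp [reassoc_of% h0]
    simp only [Preadditive.sum_comp, Preadditive.comp_sum, h]
    rw [Finset.sum_comm]
    simp only [Finset.sum_ite_eq, Finset.mem_univ, if_true]
    rw [← E.map_sum, IsBilimit.total hb, E.map_id]

lemma retractClass_isClosedUnderColimitsOfShape [Preadditive 𝒯] [HasFiniteBiproducts 𝒯]
    [Preadditive 𝒞] [E.Additive] [y.Additive] (J : Type) [Finite J]
    [X.IsClosedUnderColimitsOfShape (Discrete J)] :
    (retractClass E y X).IsClosedUnderColimitsOfShape (Discrete J) where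
  colimitsOfShape_le := by
    classical
    cases nonempty_fintype J
    rintro F ⟨p⟩
    choose Z hZ r using fun j : J => p.prop_diag_obj ⟨j⟩
    have hc := (IsColimit.precomposeHomEquiv Discrete.natIsoFunctor.symm _).symm p.isColimit
    exact ⟨⨁ Z, X.prop_of_isColimit (biproduct.isBilimit Z).isColimit fun j => hZ j.as,
      ⟨retractOfIsBilimit E y (biconeIsBilimitOfColimitCoconeOfIsColimit hc) fun j => (r j).some⟩⟩

variable {E y X} in
/-- If `E y Z ≅ y (G Z)` and `y` is fully faithful on maps into the objects `G Z`, then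
membership of `y Z` in `retractClass E y X` is membership of `Z` in `X`. -/
lemma retractClass_obj_iff [X.IsStableUnderRetracts] {G : 𝒯 → 𝒯}
    (β : ∀ Z, E.obj (y.obj Z) ≅ y.obj (G Z)) (hX : ∀ Z, X Z ↔ X (G Z))
    (hy : ∀ Z W, Function.Bijective (y.map : (W ⟶ G Z) → _)) (Z : 𝒯) :
    retractClass E y X (y.obj Z) ↔ X Z := by
  constructor
  · rintro ⟨Z', hZ', ⟨r⟩⟩
    -- a second application of `E` moves the retraction between objects in the image of `G`
    let s : Retract (y.obj (G (G Z))) (y.obj (G Z')) :=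
      ((β (G Z)).symm ≪≫ (E.mapIso (β Z)).symm).retract.trans ((r.map E).trans (β Z').retract)
    obtain ⟨a, ha⟩ := (hy _ _).2 s.i
    obtain ⟨b, hb⟩ := (hy _ _).2 s.r
    have t : Retract (G (G Z)) (G Z') := ⟨a, b, (hy _ _).1 (by
      rw [y.map_comp, ha, hb, s.retract, y.map_id])⟩
    exact (hX _).2 ((hX _).2 (X.prop_of_retract t ((hX _).1 hZ')))
  · exact fun hZ => ⟨G Z, (hX Z).1 hZ, ⟨(β Z).retract⟩⟩

variable {𝒰 : Type*} [Category* 𝒰] {𝒟 : Type*} [Category* 𝒟]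

variable {X y} in
/-- The classes attached to `X` and `Y` correspond under a duality `∂` that is compatible with `Q`
and is a retract of its double dual. -/
lemma retractClass_iff_dual {Y : ObjectProperty 𝒰} {y' : 𝒰 ⥤ 𝒟}
    {Q : 𝒯ᵒᵖ ⥤ 𝒰} {Q' : 𝒰ᵒᵖ ⥤ 𝒯} {d : 𝒞ᵒᵖ ⥤ 𝒟} {d' : 𝒟ᵒᵖ ⥤ 𝒞}
    (α : ∀ Z, d.obj (op (y.obj Z)) ≅ y'.obj (Q.obj (op Z)))
    (α' : ∀ W, d'.obj (op (y'.obj W)) ≅ y.obj (Q'.obj (op W)))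
    (ρ : ∀ G, Retract (d'.obj (op G)) (d'.obj (op (d.obj (op (d'.obj (op G)))))))
    (hXY : ∀ Z, X Z → Y (Q.obj (op Z))) (hYX : ∀ W, Y W → X (Q'.obj (op W))) (F : 𝒞) :
    retractClass (d.rightOp ⋙ d') y X F ↔
      retractClass (d'.rightOp ⋙ d) y' Y (d.obj (op F)) := by
  constructor
  · rintro ⟨Z, hZ, ⟨r⟩⟩
    exact ⟨_, hXY Z hZ, ⟨(r.op.map d).trans (α Z).retract⟩⟩
  · rintro ⟨W, hW, ⟨r⟩⟩
    exact ⟨_, hYX W hW, ⟨(ρ (d.obj (op F))).trans ((r.op.map d').trans (α' W).retract)⟩⟩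

end RetractClass

end

end AGJ

theorem mainTheorem10
    {T : Type u₁} [Category.{v} T] [Preadditive T] [HasZeroObject T] [HasShift T ℤ]
    [∀ n : ℤ, (shiftFunctor T n).Additive] [Pretriangulated T] [IsTriangulated T]
    [HasCoproducts.{v} T]
    {U : Type u₂} [Category.{v} U] [Preadditive U] [HasZeroObject U] [HasShift U ℤ]
    [∀ n : ℤ, (shiftFunctor U n).Additive] [Pretriangulated U] [IsTriangulated U]
    [HasCoproducts.{v} U]
    (hT : AGJ.IsCompactlyGenerated T) (hU : AGJ.IsCompactlyGenerated U)
    (S : AGJ.AGJDualityTriple T U)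
    (X : ObjectProperty T) (Y : ObjectProperty U)
    (hXY : AGJ.IsSymmetricDualityPair S.Q S.Q' X Y) :
    ∃ (A : ObjectProperty (AGJ.ModCompact T)) (B : ObjectProperty (AGJ.ModCompact U)),
      AGJ.IsSymmetricDualityPair S.partialDual S.partialDual' A B ∧
      A.inverseImage (AGJ.restrictedYoneda T) = X ∧
      B.inverseImage (AGJ.restrictedYoneda U) = Y := by
  have hX := hXY.left.mem_iff
  have hY := hXY.right.mem_iff
  have := hXY.left.retracts
  have := hXY.right.retracts
  refine ⟨AGJ.retractClass (S.partialDual.rightOp ⋙ S.partialDual') (AGJ.restrictedYoneda T) X,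
    AGJ.retractClass (S.partialDual'.rightOp ⋙ S.partialDual) (AGJ.restrictedYoneda U) Y,
    ⟨⟨?_, ?_, ?_⟩, ⟨?_, ?_, ?_⟩⟩, ?_, ?_⟩
  · exact AGJ.retractClass_iff_dual S.partialDualYonedaIso S.partialDualYonedaIso'
      S.retractPartialDual' (fun Z => (hX Z).1) (fun W => (hY W).1)
  · intro J _
    have := hXY.left.finiteCoproducts J
    exact AGJ.retractClass_isClosedUnderColimitsOfShape _ _ _ J
  · exact AGJ.retractClass_isStableUnderRetracts _ _ _
  · exact AGJ.retractClass_iff_dual S.partialDualYonedaIso' S.partialDualYonedaIso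
      S.retractPartialDual (fun W => (hY W).1) (fun Z => (hX Z).1)
  · intro J _
    have := hXY.right.finiteCoproducts J
    exact AGJ.retractClass_isClosedUnderColimitsOfShape _ _ _ J
  · exact AGJ.retractClass_isStableUnderRetracts _ _ _
  · ext Z
    exact AGJ.retractClass_obj_iff (G := fun Z => S.Q'.obj (op (S.Q.obj (op Z))))
      (fun Z => S.partialDual'.mapIso (S.partialDualYonedaIso Z).symm.op ≪≫
        S.partialDualYonedaIso' _)
      (fun Z => (hX Z).trans (hY _))
      (fun _ _ => ⟨(S.pureInjective_Q' _).restrictedYoneda_map_injective,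
        (S.pureInjective_Q' _).restrictedYoneda_map_surjective hT⟩) Z
  · ext W
    exact AGJ.retractClass_obj_iff (G := fun W => S.Q.obj (op (S.Q'.obj (op W))))
      (fun W => S.partialDual.mapIso (S.partialDualYonedaIso' W).symm.op ≪≫
        S.partialDualYonedaIso _)
      (fun W => (hY W).trans (hX _))
      (fun _ _ => ⟨(S.pureInjective_Q _).restrictedYoneda_map_injective,
        (S.pureInjective_Q _).restrictedYoneda_map_surjective hU⟩) W
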